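/- Let $M$ be a finite set of items, let $\mathcal C\subseteq 2^M$ be a non-empty downwards-closed set system, and for every $T\subseteq M$ let $D_T$ be a probability distribution on $[0,\infty)$ with finite support, where $D_\emptyset$ is the point mass at $0$. Draw $w=(w(T))_{T\subseteq M}$ from the product distribution $\prod_T D_T$ and let the buyer's valuation be $$v(S)=v_w(S)=\max_{T\subseteq S,\ T\in\mathcal C}\ \sum_{U\subseteq T} w(U)\qquad (S\subseteq M).$$ Let $\mathcal D$ be the distribution of $v$ and $V$ its (finite) support. A mechanism consists of maps $X:V\to\Delta(2^M)$ and $p:V\to\mathbb R$; write $v(X)=\mathbb E_{S\sim X}[v(S)]$. It is truthful if $v(X(v))-p(v)\ge v(X(v'))-p(v')$ for all $v,v'\in V$, and individually rational if $v(X(v))-p(v)\ge 0$ for all $v\in V$. Let $\mathrm{REV}(\mathcal D)$ be the supremum of $\mathbb E_{v\sim\mathcal D}[p(v)]$ over all truthful, individually rational mechanisms. Fix any total order on the subsets of $M$ (for example a lexicographic one) for breaking ties. For $A\subseteq M$ say that $w\in R_A$ if $A$ is the favorite hyperedge of $w$, that is, the first set, in this order, among those that maximize $w(T)$ over $T\subseteq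 M$. For a distribution $D_T$ as above and $X\sim D_T$, let $\bar R_T:[0,1]\to\mathbb R$ be the smallest concave function with $\bar R_T(0)\ge 0$ and $\bar R_T(\Pr[X\ge x])\ge x\Pr[X\ge x]$ for every $x$ in the support of $D_T$. The ironed virtual value of such an $x$ is $$\bar\varphi_T(x)=\frac{\bar R_T(\Pr[X\ge x])-\bar R_T(\Pr[X>x])}{\Pr[X=x]} .$$ Then $$\mathrm{REV}(\mathcal D)\ \le\ \underbrace{\mathbb E_{w}\Big[\max_{S\in\mathcal C}\ \sum_{T\subseteq S} w(T)\,\mathbf 1[w\notin R_T]\Big]}_{\text{NON-FAVORITE}}\ +\ \underbrace{\mathbb E_{w}\Big[\sum_{S\subseteq M}\max\{0,\bar\varphi_S(w(S))\}\,\mathbf 1[w\in R_S]\Big]}_{\text{SINGLE}} .$$ -/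

import Mathlib

noncomputable section

namespace HypergraphAuction

/-- A probability distribution on the non-negative reals with finite support. -/
structure ValueDist where
  pmf : PMF ℝ
  finite_support : pmf.support.Finite
  nonneg : ∀ x ∈ pmf.support, 0 ≤ x

namespace ValueDist

/-- The support, as a finite set. -/
def supp (d : ValueDist) : Finset ℝ := d.finite_support.toFinset

/-- The probability `f(x)` of the value `x`, as a real number. -/
def prob (d : ValueDist) (x : ℝ) : ℝ := (d.pmf x).toReal

/-- `Pr[X ≥ x]`. -/
def probGE (d : ValueDist) (x : ℝ) : ℝ := ∑ y ∈ d.supp with x ≤ y, d.prob y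

/-- `Pr[X > x]`. -/
def probGT (d : ValueDist) (x : ℝ) : ℝ := ∑ y ∈ d.supp with x < y, d.prob y

/-- The revenue curve in quantile space: the point `(0, 0)`, and for every value `x` in the
support the point whose abscissa is the selling probability `Pr[X ≥ x]` at price `x` and whose
ordinate is the revenue `x * Pr[X ≥ x]`. -/
def revenueCurve (d : ValueDist) : Set (ℝ × ℝ) :=
  insert (0, 0) ((fun x => (d.probGE x, x * d.probGE x)) '' (d.supp : Set ℝ))

/-- The ironed revenue curve: the upper boundary of the convex hull of the revenue curve, that
is, the smallest concave function on `[0, 1]` lying above it. -/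
def ironedRevenue (d : ValueDist) (q : ℝ) : ℝ :=
  sSup {y : ℝ | (q, y) ∈ convexHull ℝ d.revenueCurve}

/-- Myerson's ironed virtual value of a value `x` in the support: the slope of the ironed revenue
curve over the quantile interval `[Pr[X > x], Pr[X ≥ x]]`, which has length `f(x)`. (The slope of
the revenue curve itself over this interval is the virtual value
`x - (x' - x) * Pr[X > x] / f(x)`, where `x'` is the next larger value in the support.) -/
def ironedVirtualValue (d : ValueDist) (x : ℝ) : ℝ :=
  (d.ironedRevenue (d.probGE x) - d.ironedRevenue (d.probGT x)) / d.prob x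

end ValueDist

/-- A non-empty downwards-closed set system on the items. -/
structure Constraints (M : Type*) where
  sets : Finset (Finset M)
  empty_mem : ∅ ∈ sets
  down_closed : ∀ S ∈ sets, ∀ T, T ⊆ S → T ∈ sets

lemma Constraints.nonempty {M : Type*} (C : Constraints M) : C.sets.Nonempty := ⟨∅, C.empty_mem⟩

lemma Constraints.filter_nonempty {M : Type*} [DecidableEq M] (C : Constraints M) (S : Finset M) :
    (C.sets.filter (· ⊆ S)).Nonempty :=
  ⟨∅, Finset.mem_filter.2 ⟨C.empty_mem, Finset.empty_subset S⟩⟩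

section

variable {M : Type*} [Fintype M] [DecidableEq M]

/-- The valuation `v(S) = max_{T ⊆ S, T ∈ C} ∑_{U ⊆ T} w(U)` of a weight function `w`. -/
def valuation (C : Constraints M) (w : Finset M → ℝ) (S : Finset M) : ℝ :=
  (C.sets.filter (· ⊆ S)).sup' (C.filter_nonempty S) (fun T => ∑ U ∈ T.powerset, w U)

/-- The support of the product distribution `∏_T D_T`. -/
def weightSupport (D : Finset M → ValueDist) : Finset (Finset M → ℝ) :=
  Fintype.piFinset (fun T => (D T).supp)

/-- The expectation of `g(w)` for `w` drawn from the product distribution `∏_T D_T`. -/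
def expect (D : Finset M → ValueDist) (g : (Finset M → ℝ) → ℝ) : ℝ :=
  ∑ w ∈ weightSupport D, (∏ T, (D T).prob (w T)) * g w

/-- The support `V` of the distribution of the valuation. -/
def valuationSupport (C : Constraints M) (D : Finset M → ValueDist) : Set (Finset M → ℝ) :=
  valuation C '' (weightSupport D : Set (Finset M → ℝ))

/-- The value `v(X)`: the expectation of `v(S)` for the random set `S` drawn from `X`. -/
def lotteryValue (v : Finset M → ℝ) (X : PMF (Finset M)) : ℝ :=
  ∑ S, (X S).toReal * v S

/-- A direct mechanism: a reported valuation is mapped to a random set of items and a price.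
Only its restriction to the support of the valuation distribution is ever used. -/
structure Mechanism (M : Type*) where
  alloc : (Finset M → ℝ) → PMF (Finset M)
  price : (Finset M → ℝ) → ℝ

/-- Truthfulness on a set `V` of valuations. -/
def Mechanism.IsTruthful (m : Mechanism M) (V : Set (Finset M → ℝ)) : Prop :=
  ∀ v ∈ V, ∀ v' ∈ V,
    lotteryValue v (m.alloc v') - m.price v' ≤ lotteryValue v (m.alloc v) - m.price v

/-- Individual rationality on a set `V` of valuations: participating truthfully is at least as
good as receiving nothing and paying nothing. -/
def Mechanism.IsIndividuallyRational (m : Mechanism M) (V : Set (Finset M → ℝ)) : Prop :=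
  ∀ v ∈ V, 0 ≤ lotteryValue v (m.alloc v) - m.price v

/-- The expected revenue of a mechanism under truthful reporting. -/
def Mechanism.revenue (m : Mechanism M) (C : Constraints M) (D : Finset M → ValueDist) : ℝ :=
  expect D (fun w => m.price (valuation C w))

/-- `REV`: the supremum of the expected revenue over all truthful (and individually rational)
mechanisms, taken in the extended reals. -/
def rev (C : Constraints M) (D : Finset M → ValueDist) : EReal :=
  ⨆ m ∈ {m : Mechanism M | m.IsTruthful (valuationSupport C D) ∧
      m.IsIndividuallyRational (valuationSupport C D)}, ((m.revenue C D : ℝ) : EReal)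

/-- The region `R_A`: the hyperedge `A` has the largest weight, ties being broken in favour of
the hyperedge that comes first in the enumeration `tie`. -/
def InRegion (tie : Finset M ↪ ℕ) (w : Finset M → ℝ) (A : Finset M) : Prop :=
  ∀ T, w T < w A ∨ (w T = w A ∧ tie A ≤ tie T)

open Classical in
/-- `NON-FAVORITE`. -/
def nonFavorite (tie : Finset M ↪ ℕ) (C : Constraints M) (D : Finset M → ValueDist) : ℝ :=
  expect D (fun w => C.sets.sup' C.nonempty
    (fun S => ∑ T ∈ S.powerset, w T * (if ¬ InRegion tie w T then 1 else 0)))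

open Classical in
/-- `SINGLE`. -/
def single (tie : Finset M ↪ ℕ) (D : Finset M → ValueDist) : ℝ :=
  expect D (fun w => ∑ S : Finset M,
    max 0 ((D S).ironedVirtualValue (w S)) * (if InRegion tie w S then 1 else 0))

end

end HypergraphAuction

end

set_option linter.unusedSectionVars false

/-! Revenue is the expected lottery value minus the buyer's utility. If `A` is the favorite
hyperedge of `w`, the value splits into at most the best feasible sum over the other hyperedges,
giving NON-FAVORITE, plus `w A` times the probability that `A` lies in the optimal subset of the
allocated set (`lotteryValue_le`). For the second term, fix all weights except `w A`. The values of
`w A` that keep `A` favorite form an upper set of the support. There the cover probability is a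
subgradient of the utility (`utility_update_ge`), just as an allocation rule is for a single-item
buyer. A Myerson argument on that upper set (`sum_payment_le`) bounds the remaining revenue by the
positive part of the ironed virtual value, giving SINGLE (`expect_region_le`). -/

namespace HypergraphAuction

/-! ### Single-parameter revenue on an upper set of values. -/

namespace ValueDist

variable (d : ValueDist)

lemma mem_supp {x : ℝ} : x ∈ d.supp ↔ d.pmf x ≠ 0 := by
  simp [supp]

lemma prob_nonneg (x : ℝ) : 0 ≤ d.prob x := ENNReal.toReal_nonneg

lemma prob_pos {x : ℝ} (hx : x ∈ d.supp) : 0 < d.prob x :=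
  ENNReal.toReal_pos (d.mem_supp.1 hx) (d.pmf.apply_ne_top x)

lemma sum_prob : ∑ x ∈ d.supp, d.prob x = 1 := by
  have h : ∑ x ∈ d.supp, d.pmf x = 1 := by
    rw [← d.pmf.tsum_coe]
    exact (tsum_eq_sum fun x hx => by simpa using mt d.mem_supp.2 hx).symm
  unfold prob
  rw [← ENNReal.toReal_sum fun x _ => d.pmf.apply_ne_top x, h, ENNReal.toReal_one]

lemma probGE_nonneg (x : ℝ) : 0 ≤ d.probGE x := Finset.sum_nonneg fun y _ => d.prob_nonneg y

/-- The half-plane below the line of slope `B` through the origin, with `B` an upper bound of the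
support, is convex and contains the revenue curve. It makes the supremum in `ironedRevenue` finite
and pins it at quantile 0. -/
lemma exists_convexHull_revenueCurve_bound :
    ∃ B : ℝ, ∀ p ∈ convexHull ℝ d.revenueCurve, p.2 ≤ B * p.1 := by
  obtain ⟨B, hB⟩ := d.supp.bddAbove
  refine ⟨B, fun p hp => ?_⟩
  have hconv : Convex ℝ {p : ℝ × ℝ | p.2 ≤ B * p.1} := by
    intro p hp q hq a b ha hb _
    simp only [Set.mem_ofPred_eq, Prod.snd_add, Prod.smul_snd, Prod.fst_add, Prod.smul_fst,
      smul_eq_mul] at *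
    nlinarith [mul_le_mul_of_nonneg_left hp ha, mul_le_mul_of_nonneg_left hq hb]
  refine convexHull_min ?_ hconv hp
  rintro _ (rfl | ⟨x, hx, rfl⟩)
  · simp
  · exact mul_le_mul_of_nonneg_right (hB hx) (d.probGE_nonneg x)

lemma ironedRevenue_zero_nonpos : d.ironedRevenue 0 ≤ 0 := by
  obtain ⟨B, hB⟩ := d.exists_convexHull_revenueCurve_bound
  exact Real.sSup_nonpos fun y hy => by simpa using hB _ hy

lemma mul_probGE_le_ironedRevenue {x : ℝ} (hx : x ∈ d.supp) :
    x * d.probGE x ≤ d.ironedRevenue (d.probGE x) := by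
  obtain ⟨B, hB⟩ := d.exists_convexHull_revenueCurve_bound
  refine le_csSup ⟨B * d.probGE x, fun y hy => hB _ hy⟩ (subset_convexHull ℝ _ ?_)
  exact Or.inr ⟨x, hx, rfl⟩

lemma prob_mul_ironedVirtualValue {x : ℝ} (hx : x ∈ d.supp) :
    d.prob x * d.ironedVirtualValue x =
      d.ironedRevenue (d.probGE x) - d.ironedRevenue (d.probGT x) :=
  mul_div_cancel₀ _ (d.prob_pos hx).ne'

/-- The revenue from an upper set of values with least element `x₀`, for an allocation rule `a`
and a utility `u` satisfying the incentive constraints. -/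
lemma sum_payment_le_aux (a u : ℝ → ℝ) (t : Finset ℝ) :
    t ⊆ d.supp → (∀ x ∈ t, ∀ y ∈ d.supp, x ≤ y → y ∈ t) →
    (∀ x ∈ t, 0 ≤ a x) →
    (∀ x ∈ t, ∀ y ∈ t, u x + (y - x) * a x ≤ u y) →
    ∀ x₀ ∈ t, (∀ x ∈ t, x₀ ≤ x) →
    ∑ x ∈ t, d.prob x * (a x * x - u x) + d.probGE x₀ * u x₀ ≤
      ∑ x ∈ t, d.prob x * d.ironedVirtualValue x * a x -
        a x₀ * (d.ironedRevenue (d.probGE x₀) - x₀ * d.probGE x₀) := by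
  -- Summation by parts, adding values from the top down. The subtracted term is the slack between
  -- the ironed and the raw curve at the lowest value. Of the ironed curve this needs only that it
  -- dominates the raw curve and is nonpositive at 0.
  induction t using Finset.induction_on_min with
  | empty => intro _ _ _ _ x₀ h; simp at h
  | insert z t hz ih =>
    intro hsub hup ha hu x₀ hx₀ hmin
    have hzt : z ∉ t := fun h => lt_irrefl _ (hz z h)
    have hx₀z : x₀ = z := by
      refine le_antisymm (hmin z (Finset.mem_insert_self _ _)) ?_
      rcases Finset.mem_insert.1 hx₀ with h | h
      · exact h.ge
      · exact (hz _ h).le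
    subst hx₀z
    have hxs : x₀ ∈ d.supp := hsub hx₀
    have hGT : d.probGT x₀ = ∑ y ∈ t, d.prob y := by
      unfold probGT
      congr 1
      ext y
      simp only [Finset.mem_filter]
      refine ⟨fun ⟨h₁, h₂⟩ => ?_, fun h => ⟨hsub (Finset.mem_insert_of_mem h), hz y h⟩⟩
      exact (Finset.mem_insert.1 (hup _ hx₀ y h₁ h₂.le)).resolve_left h₂.ne'
    have hGE : d.probGE x₀ = d.prob x₀ + d.probGT x₀ := by
      rw [hGT, ← Finset.sum_insert hzt]
      unfold probGE
      congr 1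
      ext y
      simp only [Finset.mem_filter]
      exact ⟨fun ⟨h₁, h₂⟩ => hup _ hx₀ y h₁ h₂, fun h => ⟨hsub h, hmin y h⟩⟩
    rw [Finset.sum_insert hzt, Finset.sum_insert hzt, d.prob_mul_ironedVirtualValue hxs]
    rcases t.eq_empty_or_nonempty with rfl | hne
    · have h0 : d.probGT x₀ = 0 := by simpa using hGT
      -- At the top value the claim reduces to `a x₀` times the ironed revenue at 0 being
      -- nonpositive.
      have := mul_nonneg (ha _ hx₀) (neg_nonneg.2 d.ironedRevenue_zero_nonpos)
      rw [hGE, h0]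
      simp only [Finset.sum_empty, add_zero]
      linarith
    · set y := t.min' hne with hy
      have hyt : y ∈ t := t.min'_mem hne
      have hymin : ∀ x ∈ t, y ≤ x := fun x hx => t.min'_le x hx
      have hyi : y ∈ insert x₀ t := Finset.mem_insert_of_mem hyt
      have hsub' : t ⊆ d.supp := fun x hx => hsub (Finset.mem_insert_of_mem hx)
      have hup' : ∀ x ∈ t, ∀ y ∈ d.supp, x ≤ y → y ∈ t := fun x hx y hy hxy =>
        (Finset.mem_insert.1 (hup x (Finset.mem_insert_of_mem hx) y hy hxy)).resolve_left
          ((hz x hx).trans_le hxy).ne'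
      have key := ih hsub' hup' (fun x hx => ha x (Finset.mem_insert_of_mem hx))
        (fun x hx y hy => hu x (Finset.mem_insert_of_mem hx) y (Finset.mem_insert_of_mem hy))
        y hyt hymin
      have hGEy : d.probGE y = d.probGT x₀ := by
        rw [hGT]
        unfold probGE
        congr 1
        ext x
        simp only [Finset.mem_filter]
        exact ⟨fun ⟨h₁, h₂⟩ => hup' _ hyt x h₁ h₂, fun h => ⟨hsub' h, hymin x h⟩⟩
      have hR := d.mul_probGE_le_ironedRevenue (hsub hyi)
      have hq := d.probGE_nonneg y
      have h₁ := hu x₀ hx₀ y hyi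
      have h₂ := hu y hyi x₀ hx₀
      -- Adding the two incentive constraints gives `(y - x₀) * (a y - a x₀) ≥ 0`.
      have hmono : a x₀ ≤ a y := by
        have : 0 < y - x₀ := sub_pos.2 (hz y hyt)
        nlinarith
      rw [hGEy] at key hR hq
      rw [hGE]
      -- `e₁` shrinks the coefficient of the slack at `y` from `a y` to `a x₀`; `e₂` pays for
      -- replacing `u y` by `u x₀` on the mass above `x₀`.
      have e₁ := mul_nonneg (sub_nonneg.2 hmono) (sub_nonneg.2 hR)
      have e₂ := mul_nonneg hq (sub_nonneg.2 h₁)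
      linarith

/-- Myerson's bound: the revenue from an upper set of values is at most its ironed virtual
surplus. -/
lemma sum_payment_le (a u : ℝ → ℝ) (t : Finset ℝ) (hsub : t ⊆ d.supp)
    (hup : ∀ x ∈ t, ∀ y ∈ d.supp, x ≤ y → y ∈ t)
    (ha : ∀ x ∈ t, 0 ≤ a x) (ha' : ∀ x ∈ t, a x ≤ 1) (hu₀ : ∀ x ∈ t, 0 ≤ u x)
    (hu : ∀ x ∈ t, ∀ y ∈ t, u x + (y - x) * a x ≤ u y) :
    ∑ x ∈ t, d.prob x * (a x * x - u x) ≤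
      ∑ x ∈ t, d.prob x * max 0 (d.ironedVirtualValue x) := by
  rcases t.eq_empty_or_nonempty with rfl | hne
  · simp
  have hy := t.min'_mem hne
  have key := d.sum_payment_le_aux a u t hsub hup ha hu _ hy fun x hx => t.min'_le x hx
  have h₁ := mul_nonneg (d.probGE_nonneg (t.min' hne)) (hu₀ _ hy)
  have h₂ := mul_nonneg (ha _ hy)
    (sub_nonneg.2 (d.mul_probGE_le_ironedRevenue (hsub hy)))
  have h₃ : ∑ x ∈ t, d.prob x * d.ironedVirtualValue x * a x ≤
      ∑ x ∈ t, d.prob x * max 0 (d.ironedVirtualValue x) := by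
    refine Finset.sum_le_sum fun x hx => ?_
    rw [mul_assoc]
    refine mul_le_mul_of_nonneg_left ?_ (d.prob_nonneg x)
    calc d.ironedVirtualValue x * a x ≤ max 0 (d.ironedVirtualValue x) * a x :=
          mul_le_mul_of_nonneg_right (le_max_right _ _) (ha x hx)
      _ ≤ max 0 (d.ironedVirtualValue x) :=
          mul_le_of_le_one_right (le_max_left _ _) (ha' x hx)
  linarith

end ValueDist

/-! ### Expectations over the product distribution. -/

variable {M : Type*} [Fintype M] [DecidableEq M]

lemma expect_mono (D : Finset M → ValueDist) {g h : (Finset M → ℝ) → ℝ}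
    (hgh : ∀ w ∈ weightSupport D, g w ≤ h w) : expect D g ≤ expect D h :=
  Finset.sum_le_sum fun w hw => mul_le_mul_of_nonneg_left (hgh w hw)
    (Finset.prod_nonneg fun T _ => (D T).prob_nonneg (w T))

lemma expect_add (D : Finset M → ValueDist) (g h : (Finset M → ℝ) → ℝ) :
    expect D (fun w => g w + h w) = expect D g + expect D h := by
  simp only [expect, mul_add, Finset.sum_add_distrib]

lemma expect_sum (D : Finset M → ValueDist) {ι : Type*} (s : Finset ι)
    (g : ι → (Finset M → ℝ) → ℝ) :
    expect D (fun w => ∑ i ∈ s, g i w) = ∑ i ∈ s, expect D (g i) := by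
  simp only [expect, Finset.mul_sum]
  exact Finset.sum_comm

lemma update_mem_weightSupport {D : Finset M → ValueDist} {w : Finset M → ℝ}
    (hw : w ∈ weightSupport D) {A : Finset M} {x : ℝ} (hx : x ∈ (D A).supp) :
    Function.update w A x ∈ weightSupport D := by
  simp only [weightSupport, Fintype.mem_piFinset] at hw ⊢
  intro T
  by_cases h : T = A
  · subst h; simpa using hx
  · simpa [h] using hw T

open Finset in
/-- Resampling one coordinate of a product distribution does not change expectations. -/
lemma expect_resample
    (D : Finset M → ValueDist) (A : Finset M) (g : (Finset M → ℝ) → ℝ) :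
    expect D g =
      expect D (fun w => ∑ x ∈ (D A).supp, (D A).prob x * g (Function.update w A x)) := by
  have hprod : ∀ (w : Finset M → ℝ) (x : ℝ),
      (∏ T, (D T).prob (w T)) * (D A).prob x =
        (∏ T, (D T).prob (Function.update w A x T)) * (D A).prob (w A) := by
    intro w x
    rw [← Finset.mul_prod_erase univ _ (mem_univ A), ← Finset.mul_prod_erase univ
      (fun T => (D T).prob (Function.update w A x T)) (mem_univ A)]
    have : ∏ T ∈ univ.erase A, (D T).prob (Function.update w A x T) =
        ∏ T ∈ univ.erase A, (D T).prob (w T) :=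
      prod_congr rfl fun T hT => by rw [Function.update_of_ne (ne_of_mem_erase hT)]
    rw [this, Function.update_self]
    ring
  calc expect D g
      = ∑ w ∈ weightSupport D, ∑ x ∈ (D A).supp,
          (∏ T, (D T).prob (w T)) * (D A).prob x * g w := by
        refine sum_congr rfl fun w _ => ?_
        rw [← sum_mul, ← mul_sum, (D A).sum_prob, mul_one]
    _ = ∑ w ∈ weightSupport D, ∑ x ∈ (D A).supp,
          (∏ T, (D T).prob (w T)) * (D A).prob x * g (Function.update w A x) := by
        rw [← sum_product', ← sum_product']
        -- Exchanging `w A` with the fresh sample `x` is an involution that preserves the joint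
        -- weight.
        refine sum_bij' (fun p _ => (Function.update p.1 A p.2, p.1 A))
          (fun p _ => (Function.update p.1 A p.2, p.1 A)) ?_ ?_ ?_ ?_ ?_
        · rintro ⟨w, x⟩ h
          rw [mem_product] at h ⊢
          exact ⟨update_mem_weightSupport h.1 h.2, Fintype.mem_piFinset.1 h.1 A⟩
        · rintro ⟨w, x⟩ h
          rw [mem_product] at h ⊢
          exact ⟨update_mem_weightSupport h.1 h.2, Fintype.mem_piFinset.1 h.1 A⟩
        · rintro ⟨w, x⟩ _; simp
        · rintro ⟨w, x⟩ _; simp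
        · rintro ⟨w, x⟩ _
          simp only [Function.update_idem, Function.update_eq_self]
          rw [hprod w x]
    _ = _ := by
        refine sum_congr rfl fun w _ => ?_
        rw [mul_sum]
        exact sum_congr rfl fun x _ => by ring

/-! ### The valuation as a function of one weight. -/

lemma exists_optimal (C : Constraints M) (w : Finset M → ℝ) (S : Finset M) :
    ∃ T ∈ C.sets.filter (· ⊆ S), valuation C w S = ∑ U ∈ T.powerset, w U :=
  Finset.exists_mem_eq_sup' _ _

/-- A feasible subset of `S` attaining the valuation of `S`. -/
noncomputable def optimal (C : Constraints M) (w : Finset M → ℝ) (S : Finset M) : Finset M :=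
  (exists_optimal C w S).choose

lemma optimal_mem (C : Constraints M) (w : Finset M → ℝ) (S : Finset M) :
    optimal C w S ∈ C.sets.filter (· ⊆ S) :=
  (exists_optimal C w S).choose_spec.1

lemma valuation_eq_sum_optimal (C : Constraints M) (w : Finset M → ℝ) (S : Finset M) :
    valuation C w S = ∑ U ∈ (optimal C w S).powerset, w U :=
  (exists_optimal C w S).choose_spec.2

lemma sum_powerset_le_valuation (C : Constraints M) (w : Finset M → ℝ) {S T : Finset M}
    (hT : T ∈ C.sets.filter (· ⊆ S)) : ∑ U ∈ T.powerset, w U ≤ valuation C w S :=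
  Finset.le_sup' (fun T => ∑ U ∈ T.powerset, w U) hT

lemma sum_powerset_update (w : Finset M → ℝ) (A T : Finset M) (y : ℝ) :
    ∑ U ∈ T.powerset, Function.update w A y U =
      ∑ U ∈ T.powerset, w U + (y - w A) * (if A ⊆ T then 1 else 0) := by
  rw [← sub_eq_iff_eq_add', ← Finset.sum_sub_distrib]
  have : ∀ U, Function.update w A y U - w U = if A = U then y - w A else 0 := by
    intro U
    by_cases h : A = U
    · subst h; simp
    · simp [h, Ne.symm h]
  simp only [this, Finset.sum_ite_eq, Finset.mem_powerset]
  split_ifs <;> simp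

/-- As a function of `w A`, the valuation is a maximum of affine functions of slope 0 or 1, so the
slope of a maximizer is a subgradient. -/
lemma valuation_update_ge (C : Constraints M) (w : Finset M → ℝ) (A S : Finset M) (y : ℝ) :
    valuation C w S + (y - w A) * (if A ⊆ optimal C w S then 1 else 0) ≤
      valuation C (Function.update w A y) S := by
  rw [valuation_eq_sum_optimal C w S, ← sum_powerset_update]
  exact sum_powerset_le_valuation C _ (optimal_mem C w S)

lemma sum_toReal_pmf {α : Type*} [Fintype α] (X : PMF α) : ∑ S, (X S).toReal = 1 := by
  rw [← ENNReal.toReal_sum fun S _ => X.apply_ne_top S, ← tsum_fintype (L := .unconditional _),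
    X.tsum_coe, ENNReal.toReal_one]

/-- The probability that `A` is contained in the optimal subset of a random set. -/
noncomputable def coverProb (C : Constraints M) (w : Finset M → ℝ) (X : PMF (Finset M)) (A : Finset M) : ℝ :=
  ∑ S, (X S).toReal * (if A ⊆ optimal C w S then 1 else 0)

lemma coverProb_nonneg (C : Constraints M) (w : Finset M → ℝ) (X : PMF (Finset M))
    (A : Finset M) : 0 ≤ coverProb C w X A :=
  Finset.sum_nonneg fun S _ => mul_nonneg ENNReal.toReal_nonneg (by split_ifs <;> simp)

lemma coverProb_le_one (C : Constraints M) (w : Finset M → ℝ) (X : PMF (Finset M))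
    (A : Finset M) : coverProb C w X A ≤ 1 := by
  rw [← sum_toReal_pmf X]
  exact Finset.sum_le_sum fun S _ =>
    mul_le_of_le_one_right ENNReal.toReal_nonneg (by split_ifs <;> simp)

lemma lotteryValue_update_ge (C : Constraints M) (w : Finset M → ℝ) (X : PMF (Finset M))
    (A : Finset M) (y : ℝ) :
    lotteryValue (valuation C w) X + (y - w A) * coverProb C w X A ≤
      lotteryValue (valuation C (Function.update w A y)) X := by
  unfold lotteryValue coverProb
  rw [Finset.mul_sum, ← Finset.sum_add_distrib]
  refine Finset.sum_le_sum fun S _ => ?_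
  have := mul_le_mul_of_nonneg_left (valuation_update_ge C w A S y)
    (ENNReal.toReal_nonneg (a := X S))
  linarith

/-! ### Regions of favorite hyperedges. -/

lemma InRegion.eq {tie : Finset M ↪ ℕ} {w : Finset M → ℝ} {A B : Finset M}
    (hA : InRegion tie w A) (hB : InRegion tie w B) : A = B := by
  rcases hA B with h | ⟨h, h'⟩
  · rcases hB A with k | ⟨k, _⟩ <;> linarith
  · rcases hB A with k | ⟨_, k⟩
    · linarith
    · exact tie.injective (le_antisymm h' k)

lemma exists_inRegion (tie : Finset M ↪ ℕ) (w : Finset M → ℝ) : ∃ A, InRegion tie w A := by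
  obtain ⟨B, -, hB⟩ := Finset.exists_max_image Finset.univ w ⟨∅, Finset.mem_univ _⟩
  obtain ⟨A, hA, hA'⟩ := Finset.exists_min_image (Finset.univ.filter fun T => w T = w B) tie
    ⟨B, by simp⟩
  simp only [Finset.mem_filter, Finset.mem_univ, true_and, forall_const] at hA hA' hB
  refine ⟨A, fun T => ?_⟩
  rw [hA]
  rcases (hB T).lt_or_eq with h | h
  · exact Or.inl h
  · exact Or.inr ⟨h, hA' T h⟩

/-- This makes the values of `w A` in the region of `A` an upper set, as `sum_payment_le` requires.
-/
lemma InRegion.update {tie : Finset M ↪ ℕ} {w : Finset M → ℝ} {A : Finset M} {x y : ℝ}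
    (h : InRegion tie (Function.update w A x) A) (hxy : x ≤ y) :
    InRegion tie (Function.update w A y) A := by
  intro T
  by_cases hT : T = A
  · subst hT; exact Or.inr ⟨rfl, le_rfl⟩
  · have := h T
    simp only [Function.update_self, Function.update_of_ne hT] at this ⊢
    rcases this with h | ⟨h, h'⟩
    · exact Or.inl (h.trans_le hxy)
    · rcases hxy.lt_or_eq with k | rfl
      · exact Or.inl (h.trans_lt k)
      · exact Or.inr ⟨h, h'⟩

open Classical in
/-- The value of a lottery is bounded by the contribution of the favorite hyperedge and the best
feasible value of the other hyperedges. -/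
lemma lotteryValue_le (tie : Finset M ↪ ℕ) (C : Constraints M) (w : Finset M → ℝ)
    (X : PMF (Finset M)) {A : Finset M} (hA : InRegion tie w A) :
    lotteryValue (valuation C w) X ≤ C.sets.sup' C.nonempty
      (fun S => ∑ T ∈ S.powerset, w T * (if ¬ InRegion tie w T then 1 else 0)) +
      coverProb C w X A * w A := by
  set N := C.sets.sup' C.nonempty
    (fun S => ∑ T ∈ S.powerset, w T * (if ¬ InRegion tie w T then 1 else 0)) with hN
  have hval : ∀ S, valuation C w S ≤ N + (if A ⊆ optimal C w S then 1 else 0) * w A := by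
    intro S
    have h₁ : ∑ T ∈ (optimal C w S).powerset, w T * (if ¬ InRegion tie w T then 1 else 0) ≤ N :=
      Finset.le_sup' (fun S => ∑ T ∈ S.powerset, w T * (if ¬ InRegion tie w T then 1 else 0))
        (Finset.mem_filter.1 (optimal_mem C w S)).1
    -- Discarding the favorite hyperedge amounts to setting its weight to 0.
    have hpt : ∀ T, w T * (if ¬ InRegion tie w T then 1 else 0) =
        Function.update w A 0 T := by
      intro T
      by_cases hT : T = A
      · subst hT; simp [hA]
      · have : ¬ InRegion tie w T := fun h => hT (h.eq hA)
        simp [this, hT]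
    simp only [hpt] at h₁
    rw [sum_powerset_update, ← valuation_eq_sum_optimal] at h₁
    linarith
  calc lotteryValue (valuation C w) X
      ≤ ∑ S, (X S).toReal * (N + (if A ⊆ optimal C w S then 1 else 0) * w A) :=
        Finset.sum_le_sum fun S _ => mul_le_mul_of_nonneg_left (hval S) ENNReal.toReal_nonneg
    _ = N + coverProb C w X A * w A := by
        simp only [mul_add, Finset.sum_add_distrib, ← mul_assoc, ← Finset.sum_mul, coverProb]
        rw [sum_toReal_pmf, one_mul]

/-! ### Incentive constraints and the revenue decomposition. -/

/-- The utility of a buyer with weights `w` under truthful reporting. -/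
noncomputable def utility (m : Mechanism M) (C : Constraints M) (w : Finset M → ℝ) : ℝ :=
  lotteryValue (valuation C w) (m.alloc (valuation C w)) - m.price (valuation C w)

/-- The buyer whose weight of `A` is `y` may report `w`; the lottery intended for `w` then gains at
least the subgradient term. -/
lemma utility_update_ge {m : Mechanism M} {C : Constraints M} {D : Finset M → ValueDist}
    (hm : m.IsTruthful (valuationSupport C D)) {w : Finset M → ℝ} (hw : w ∈ weightSupport D)
    {A : Finset M} {y : ℝ} (hy : y ∈ (D A).supp) :
    utility m C w + (y - w A) * coverProb C w (m.alloc (valuation C w)) A ≤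
      utility m C (Function.update w A y) := by
  have h₁ := hm _ ⟨_, update_mem_weightSupport hw hy, rfl⟩ _ ⟨w, hw, rfl⟩
  have h₂ := lotteryValue_update_ge C w (m.alloc (valuation C w)) A y
  unfold utility
  linarith

open Classical in
/-- On the region of `A`, the revenue attributed to `A` is at most the ironed virtual surplus. -/
lemma expect_region_le (tie : Finset M ↪ ℕ) {m : Mechanism M} {C : Constraints M}
    {D : Finset M → ValueDist} (hm : m.IsTruthful (valuationSupport C D))
    (hir : m.IsIndividuallyRational (valuationSupport C D)) (A : Finset M) :
    expect D (fun w => (coverProb C w (m.alloc (valuation C w)) A * w A - utility m C w) *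
        (if InRegion tie w A then 1 else 0)) ≤
      expect D (fun w => max 0 ((D A).ironedVirtualValue (w A)) *
        (if InRegion tie w A then 1 else 0)) := by
  rw [expect_resample D A _,
    expect_resample D A (fun w => max 0 _ * _)]
  -- After resampling coordinate `A`, the inequality holds for each fixed choice of the other
  -- weights.
  refine expect_mono D fun w hw => ?_
  simp only [mul_ite, mul_one, mul_zero, Function.update_self, ← Finset.sum_filter]
  refine (D A).sum_payment_le
    (fun x => coverProb C (Function.update w A x)
      (m.alloc (valuation C (Function.update w A x))) A)
    (fun x => utility m C (Function.update w A x)) _ (Finset.filter_subset _ _) ?_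
    (fun x _ => coverProb_nonneg _ _ _ _) (fun x _ => coverProb_le_one _ _ _ _) ?_ ?_
  · intro x hx y hy hxy
    exact Finset.mem_filter.2 ⟨hy, (Finset.mem_filter.1 hx).2.update hxy⟩
  · intro x hx
    exact hir _ ⟨_, update_mem_weightSupport hw (Finset.mem_filter.1 hx).1, rfl⟩
  · intro x hx y hy
    have := utility_update_ge hm (update_mem_weightSupport hw (Finset.mem_filter.1 hx).1)
      (Finset.mem_filter.1 hy).1
    simpa using this

lemma revenue_le (tie : Finset M ↪ ℕ) {m : Mechanism M} {C : Constraints M}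
    {D : Finset M → ValueDist} (hm : m.IsTruthful (valuationSupport C D))
    (hir : m.IsIndividuallyRational (valuationSupport C D)) :
    m.revenue C D ≤ nonFavorite tie C D + single tie D := by
  classical
  unfold Mechanism.revenue nonFavorite single
  rw [expect_sum]
  refine le_trans ?_ (add_le_add_right
    (Finset.sum_le_sum fun A _ => expect_region_le tie hm hir A) _)
  rw [← expect_sum, ← expect_add]
  refine expect_mono D fun w _ => ?_
  -- The regions partition the weight functions, so one summand survives and the utility is
  -- subtracted exactly once.
  obtain ⟨A, hA⟩ := exists_inRegion tie w
  have hother : ∀ B ∈ Finset.univ, B ≠ A →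
      (coverProb C w (m.alloc (valuation C w)) B * w B - utility m C w) *
        (if InRegion tie w B then (1 : ℝ) else 0) = 0 := fun B _ hB => by
    rw [if_neg fun h => hB (h.eq hA), mul_zero]
  rw [Finset.sum_eq_single A hother fun h => absurd (Finset.mem_univ A) h, if_pos hA, mul_one]
  have := lotteryValue_le tie C w (m.alloc (valuation C w)) hA
  unfold utility
  linarith

end HypergraphAuction

theorem corollary3p1 {M : Type*} [Fintype M] [DecidableEq M]
    (tie : Finset M ↪ ℕ)
    (C : HypergraphAuction.Constraints M)
    (D : Finset M → HypergraphAuction.ValueDist)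
    (hnorm : (D ∅).pmf = PMF.pure 0) :
    HypergraphAuction.rev C D ≤
      ((HypergraphAuction.nonFavorite tie C D + HypergraphAuction.single tie D : ℝ) : EReal) := by
  exact iSup₂_le fun m hm => EReal.coe_le_coe_iff.2 (HypergraphAuction.revenue_le tie hm.1 hm.2)
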